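/- An mm-space is a triple $(X,d_X,\mu_X)$ in which $(X,d_X)$ is a complete separable metric space and $\mu_X$ is a Borel probability measure on $X$ with $\operatorname{supp}\mu_X=X$; a triple whose measure does not have full support is identified with the mm-space carried by the support of its measure. Let $\mathcal X$ be the set of mm-isomorphism classes of mm-spaces, where an mm-isomorphism is a measure-preserving surjective isometry. Write $Y\prec X$ if there is a $1$-Lipschitz map $f:X\to Y$ with $f_*\mu_X=\mu_Y$. Let $I=[0,1)$ with Lebesgue measure $\mathcal L^1$. A parameter of $X$ is a Borel map $\varphi:I\to X$ with $\varphi_*\mathcal L^1=\mu_X$, and $\varphi^*d_X(s,t)=d_X(\varphi(s),\varphi(t))$. With respect to a distance function $d$, the Hausdorff distance $d_H(A,B)$ is the infimum of the $\varepsilon\ge 0$ such that each of $A$, $B$ lies in the closed $\varepsilon$-neighbourhood of the other. Define $$d_{\mathrm{conc}}(X,Y)=\inf_{\varphi,\psi} d_H\bigl(\mathcal Lip_1(\varphi^*d_X),\mathcal Lip_1(\psi^*d_Y)\bigr),$$ where $\varphi,\psi$ run over all parameters of $X,Y$, where $\mathcal Lip_1(\sigma)$ is the set of real functions on $I$ that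 are $1$-Lipschitz for the pseudo-metric $\sigma$, and where $d_H$ is taken with respect to the Ky Fan metric $d_{KF}(f,g)=\inf\{\varepsilon\ge 0 : \mathcal L^1(|f-g|>\varepsilon)\le\varepsilon\}$. Define the box distance by $\square(X,Y)=\inf_{\varphi,\psi}\square(\varphi^*d_X,\psi^*d_Y)$, where $\square(\sigma_1,\sigma_2)$ is the infimum of the $\varepsilon\ge 0$ for which there is a Borel set $I_0\subset I$ with $\mathcal L^1(I_0)\ge 1-\varepsilon$ and $|\sigma_1(s,t)-\sigma_2(s,t)|\le\varepsilon$ for all $s,t\in I_0$. A pyramid is a nonempty $\square$-closed subset $\mathcal P\subset\mathcal X$ such that $X\in\mathcal P$ and $Y\prec X$ imply $Y\in\mathcal P$, and such that any two $X,X'\in\mathcal P$ satisfy $X\prec Y$ and $X'\prec Y$ for some $Y\in\mathcal P$. Let $\Pi$ be the set of pyramids. For $k\ge 1$ let $\mathcal X(k,k)$ be the set of the classes of $(B^k_k,\|\cdot\|_\infty,\mu)$, where $B^k_k=\{x\in\mathbb R^k : \|x\|_\infty\le k\}$ and $\mu$ is a Borel probability measure on $\mathbb R^k$ supported in $B^k_k$.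 For $\mathcal P,\mathcal P'\in\Pi$ put $$\rho(\mathcal P,\mathcal P')=\sum_{k=1}^\infty 2^{-k}\,\frac1{4k}\,d_H\bigl(\mathcal P\cap\mathcal X(k,k),\mathcal P'\cap\mathcal X(k,k)\bigr),$$ where $d_H$ is taken with respect to $\square$. Theorem. For every mm-space $X$ the set $\mathcal P_X=\{X'\in\mathcal X : X'\prec X\}$ is a pyramid, and for any two mm-spaces $X$ and $Y$, $$\rho(\mathcal P_X,\mathcal P_Y)\le d_{\mathrm{conc}}(X,Y).$$ That is, the map $\iota:\mathcal X\to\Pi$, $X\mapsto\mathcal P_X$, is well defined and $1$-Lipschitz with respect to $d_{\mathrm{conc}}$ and $\rho$. -/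

import Mathlib

open MeasureTheory Set
open scoped ENNReal

universe u v w

noncomputable section

/-! ### mm-spaces -/

/-- An mm-space: a complete separable metric space with a Borel probability measure
of full support. -/
structure MMSpace : Type (u + 1) where
  carrier : Type u
  [metric : MetricSpace carrier]
  [complete : CompleteSpace carrier]
  [separable : TopologicalSpace.SeparableSpace carrier]
  [measurable : MeasurableSpace carrier]
  [borel : BorelSpace carrier]
  μ : Measure carrier
  [prob : IsProbabilityMeasure μ]
  supp_eq : μ.support = Set.univ

namespace MMSpace

instance : CoeSort MMSpace.{u} (Type u) := ⟨MMSpace.carrier⟩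

attribute [instance] MMSpace.metric MMSpace.complete MMSpace.separable MMSpace.measurable
  MMSpace.borel MMSpace.prob

/-- mm-isomorphism: a measure preserving (surjective) isometry. -/
def Iso (X : MMSpace.{u}) (Y : MMSpace.{v}) : Prop :=
  ∃ f : X ≃ᵢ Y, X.μ.map f = Y.μ

/-- The Lipschitz order `Y ≺ X`: some `1`-Lipschitz map `X → Y` pushes `μ_X` to `μ_Y`. -/
def Dom (Y : MMSpace.{v}) (X : MMSpace.{u}) : Prop :=
  ∃ f : X → Y, LipschitzWith 1 f ∧ X.μ.map f = Y.μ

theorem Iso.refl (X : MMSpace.{u}) : X.Iso X :=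
  ⟨IsometryEquiv.refl X, Measure.map_id⟩

theorem Iso.symm {X : MMSpace.{u}} {Y : MMSpace.{v}} (h : X.Iso Y) : Y.Iso X := by
  obtain ⟨f, hf⟩ := h
  refine ⟨f.symm, ?_⟩
  rw [← hf, Measure.map_map f.symm.continuous.measurable f.continuous.measurable]
  have : (f.symm ∘ f : X → X) = id := by
    funext x
    exact f.symm_apply_apply x
  rw [this, Measure.map_id]

theorem Iso.trans {X : MMSpace.{u}} {Y : MMSpace.{v}} {Z : MMSpace.{w}}
    (h : X.Iso Y) (h' : Y.Iso Z) : X.Iso Z := by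
  obtain ⟨f, hf⟩ := h
  obtain ⟨g, hg⟩ := h'
  refine ⟨f.trans g, ?_⟩
  rw [← hg, ← hf, Measure.map_map g.continuous.measurable f.continuous.measurable]
  rfl

theorem Iso.dom {X : MMSpace.{u}} {Y : MMSpace.{v}} (h : X.Iso Y) : Y.Dom X := by
  obtain ⟨f, hf⟩ := h
  exact ⟨f, (IsometryEquiv.isometry f).lipschitz, hf⟩

theorem Dom.trans {X : MMSpace.{u}} {Y : MMSpace.{v}} {Z : MMSpace.{w}}
    (h : X.Dom Y) (h' : Y.Dom Z) : X.Dom Z := by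
  obtain ⟨f, hf, hf'⟩ := h
  obtain ⟨g, hg, hg'⟩ := h'
  refine ⟨f ∘ g, by simpa using hf.comp hg, ?_⟩
  rw [← hf', ← hg', Measure.map_map hf.continuous.measurable hg.continuous.measurable]

end MMSpace

/-! ### Parameters and pseudo-metrics on the unit interval -/

/-- The interval `I = [0, 1)`. -/
abbrev UInt01 : Type := Set.Ico (0 : ℝ) 1

/-- The one-dimensional Lebesgue measure on `I = [0, 1)`. -/
def lebI : Measure UInt01 := (volume : Measure ℝ).comap Subtype.val

/-- A parameter of `X`: a Borel map `φ : I → X` with `φ_* ℒ¹ = μ_X`. -/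
def MMSpace.Param (X : MMSpace.{u}) : Type u :=
  {φ : UInt01 → X // Measurable φ ∧ lebI.map φ = X.μ}

/-- The pull-back pseudo-metric `φ^* d_X` on `I`. -/
def MMSpace.Param.pull {X : MMSpace.{u}} (φ : X.Param) (s t : UInt01) : ℝ :=
  dist (φ.1 s) (φ.1 t)

/-- The infimum of `D (φ^* d_X) (ψ^* d_Y)` over all parameters `φ` of `X` and `ψ` of `Y`. -/
def MMSpace.paramInf (D : (UInt01 → UInt01 → ℝ) → (UInt01 → UInt01 → ℝ) → ℝ≥0∞)
    (X : MMSpace.{u}) (Y : MMSpace.{v}) : ℝ≥0∞ :=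
  ⨅ (φ : X.Param) (ψ : Y.Param), D φ.pull ψ.pull

theorem MMSpace.Param.exists_pull_eq {X : MMSpace.{u}} {X' : MMSpace.{v}} (h : X.Iso X')
    (φ : X.Param) : ∃ φ' : X'.Param, φ'.pull = φ.pull := by
  obtain ⟨f, hf⟩ := h
  refine ⟨⟨f ∘ φ.1, f.continuous.measurable.comp φ.2.1, ?_⟩, ?_⟩
  · rw [← Measure.map_map f.continuous.measurable φ.2.1, φ.2.2, hf]
  · funext s t
    exact (IsometryEquiv.isometry f).dist_eq _ _

theorem MMSpace.paramInf_le (D : (UInt01 → UInt01 → ℝ) → (UInt01 → UInt01 → ℝ) → ℝ≥0∞)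
    {X X' : MMSpace.{u}} {Y Y' : MMSpace.{v}} (hX : X.Iso X') (hY : Y.Iso Y') :
    paramInf D X' Y' ≤ paramInf D X Y := by
  refine le_iInf fun φ => le_iInf fun ψ => ?_
  obtain ⟨φ', h1⟩ := MMSpace.Param.exists_pull_eq hX φ
  obtain ⟨ψ', h2⟩ := MMSpace.Param.exists_pull_eq hY ψ
  rw [← h1, ← h2]
  exact iInf_le_of_le φ' (iInf_le _ ψ')

theorem MMSpace.paramInf_congr (D : (UInt01 → UInt01 → ℝ) → (UInt01 → UInt01 → ℝ) → ℝ≥0∞)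
    {X X' : MMSpace.{u}} {Y Y' : MMSpace.{v}} (hX : X.Iso X') (hY : Y.Iso Y') :
    paramInf D X Y = paramInf D X' Y' :=
  le_antisymm (paramInf_le D hX.symm hY.symm) (paramInf_le D hX hY)

/-- The Hausdorff distance between two subsets with respect to a distance function `d`:
the infimum of the `ε` such that each set lies in the closed `ε`-neighbourhood of the other. -/
def hausdorffOf {α : Type w} (d : α → α → ℝ≥0∞) (A B : Set α) : ℝ≥0∞ :=
  sInf {ε : ℝ≥0∞ | (∀ a ∈ A, (⨅ b ∈ B, d a b) ≤ ε) ∧ (∀ b ∈ B, (⨅ a ∈ A, d b a) ≤ ε)}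

/-- The box distance between two pseudo-metrics on `I`
(the last condition says `ℒ¹(I₀) ≥ 1 - ε`). -/
def boxPseudo (d₁ d₂ : UInt01 → UInt01 → ℝ) : ℝ≥0∞ :=
  sInf {ε : ℝ≥0∞ | ∃ I₀ : Set UInt01, MeasurableSet I₀ ∧
    (∀ s ∈ I₀, ∀ t ∈ I₀, ENNReal.ofReal |d₁ s t - d₂ s t| ≤ ε) ∧
    1 ≤ lebI I₀ + ε}

/-- The Ky Fan metric on functions `I → ℝ`, with respect to Lebesgue measure. -/
def kyFan (f g : UInt01 → ℝ) : ℝ≥0∞ :=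
  sInf {ε : ℝ≥0∞ | lebI {s : UInt01 | ε < ENNReal.ofReal |f s - g s|} ≤ ε}

/-- The `1`-Lipschitz functions on `I` with respect to a pseudo-metric. -/
def lipOne (d : UInt01 → UInt01 → ℝ) : Set (UInt01 → ℝ) :=
  {f | ∀ s t, |f s - f t| ≤ d s t}

/-- The observable distance between two pseudo-metrics on `I`. -/
def dconcPseudo (d₁ d₂ : UInt01 → UInt01 → ℝ) : ℝ≥0∞ :=
  hausdorffOf kyFan (lipOne d₁) (lipOne d₂)

/-- The box distance between mm-spaces. -/
def MMSpace.box (X : MMSpace.{u}) (Y : MMSpace.{v}) : ℝ≥0∞ :=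
  MMSpace.paramInf boxPseudo X Y

/-- The observable distance between mm-spaces. -/
def MMSpace.dconc (X : MMSpace.{u}) (Y : MMSpace.{v}) : ℝ≥0∞ :=
  MMSpace.paramInf dconcPseudo X Y

/-! ### mm-isomorphism classes -/

instance MMSpace.setoid : Setoid MMSpace.{u} where
  r := MMSpace.Iso
  iseqv := ⟨MMSpace.Iso.refl, MMSpace.Iso.symm, MMSpace.Iso.trans⟩

/-- The set `𝒳` of mm-isomorphism classes of mm-spaces. -/
def MMClass : Type (u + 1) := Quotient MMSpace.setoid.{u}

/-- The mm-isomorphism class of an mm-space. -/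
def MMSpace.cls (X : MMSpace.{u}) : MMClass.{u} := Quotient.mk MMSpace.setoid X

namespace MMClass

/-- The Lipschitz order on `𝒳`. -/
def Dom (y x : MMClass.{u}) : Prop :=
  Quotient.liftOn₂ y x (fun Y X => MMSpace.Dom Y X) fun _ _ _ _ hY hX =>
    propext ⟨fun h => (MMSpace.Iso.dom hY).trans (h.trans (MMSpace.Iso.dom hX.symm)),
      fun h => (MMSpace.Iso.dom hY.symm).trans (h.trans (MMSpace.Iso.dom hX))⟩

/-- The box distance on `𝒳`. -/
def box (x y : MMClass.{u}) : ℝ≥0∞ :=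
  Quotient.liftOn₂ x y MMSpace.box fun _ _ _ _ hX hY => MMSpace.paramInf_congr _ hX hY

/-- The observable distance on `𝒳`. -/
def dconc (x y : MMClass.{u}) : ℝ≥0∞ :=
  Quotient.liftOn₂ x y MMSpace.dconc fun _ _ _ _ hX hY => MMSpace.paramInf_congr _ hX hY

end MMClass

/-! ### Pyramids -/

/-- A pyramid: a nonempty, box-closed, downward closed and directed subset of `𝒳`. -/
structure IsPyramid (P : Set MMClass.{u}) : Prop where
  lower : ∀ x ∈ P, ∀ y : MMClass.{u}, y.Dom x → y ∈ P
  directed : ∀ x ∈ P, ∀ x' ∈ P, ∃ y ∈ P, MMClass.Dom x y ∧ MMClass.Dom x' y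
  nonempty : P.Nonempty
  closed : ∀ x : MMClass.{u}, (∀ ε : ℝ≥0∞, 0 < ε → ∃ y ∈ P, MMClass.box y x < ε) → x ∈ P

/-- The set `Π` of pyramids. -/
def Pyramid : Type (u + 1) := {P : Set MMClass.{u} // IsPyramid P}

/-- The set `𝒫_X` of all elements of `𝒳` dominated by `X`. -/
def MMSpace.dominated (X : MMSpace.{u}) : Set MMClass.{u} := {x | x.Dom X.cls}

theorem comap_support_eq {α : Type u} [MetricSpace α] [TopologicalSpace.SeparableSpace α]
    [MeasurableSpace α] [BorelSpace α] (m : Measure α) (s : Set α) :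
    m.comap (Subtype.val : m.support → α) (Subtype.val ⁻¹' s) = m s := by
  have hs : MeasurableSet m.support := Measure.isClosed_support.measurableSet
  have : SecondCountableTopology α := UniformSpace.secondCountable_of_separable α
  rw [(MeasurableEmbedding.subtype_coe hs).comap_apply, Subtype.image_preimage_coe, inter_comm]
  exact measure_inter_conull Measure.measure_compl_support

/-- The mm-space `(supp m, d, m)`, which represents the class of `(α, d, m)`. -/
def MMSpace.ofMeasure {α : Type u} [MetricSpace α] [CompleteSpace α]
    [TopologicalSpace.SeparableSpace α] [MeasurableSpace α] [BorelSpace α]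
    (m : Measure α) [IsProbabilityMeasure m] : MMSpace.{u} :=
  haveI : SecondCountableTopology α := UniformSpace.secondCountable_of_separable α
  { carrier := m.support
    complete := Measure.isClosed_support.completeSpace_coe
    μ := m.comap Subtype.val
    prob := ⟨by simpa using comap_support_eq m Set.univ⟩
    supp_eq := by
      refine Set.eq_univ_of_forall fun x => ?_
      rw [Measure.mem_support_iff_forall]
      intro U hU
      obtain ⟨V, hV, hVU⟩ := mem_nhds_subtype _ _ _ |>.1 hU
      refine lt_of_lt_of_le ?_ (measure_mono hVU)
      rw [comap_support_eq]
      exact (Measure.mem_support_iff_forall _).1 x.2 V hV }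

/-- `𝒳(N, R)`: the classes of the spaces `(B^N_R, ‖·‖_∞, m)`, where `m` is a Borel probability
measure on `ℝ^N` supported in `B^N_R = {x | ‖x‖_∞ ≤ R}`.
(`Fin N → ℝ` carries the supremum norm.) -/
def XNR (N : ℕ) (R : ℝ) : Set MMClass.{u} :=
  {x | ∃ (X : MMSpace.{u}) (m : Measure (Fin N → ℝ)) (_ : IsProbabilityMeasure m),
    X.cls = x ∧ m.support ⊆ Metric.closedBall 0 R ∧ X.Iso (MMSpace.ofMeasure m)}

namespace Pyramid

/-- `ρ_k(P, Q) = (1 / 4k) d_H(P ∩ 𝒳(k, k), Q ∩ 𝒳(k, k))`, where `d_H` is taken with respect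
to the box distance. -/
def rhoK (k : ℕ) (P Q : Pyramid.{u}) : ℝ≥0∞ :=
  (4 * (k : ℝ≥0∞))⁻¹ * hausdorffOf MMClass.box (P.1 ∩ XNR k k) (Q.1 ∩ XNR k k)

/-- `ρ(P, Q) = ∑_{k ≥ 1} 2^{-k} ρ_k(P, Q)`. -/
def rho (P Q : Pyramid.{u}) : ℝ≥0∞ :=
  ∑' k : ℕ, (2⁻¹ : ℝ≥0∞) ^ (k + 1) * rhoK (k + 1) P Q

end Pyramid

end

/-! Only closedness of `𝒫_X` needs work: the order is transitive and `X` itself bounds any two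
members. Let `Z` be a box limit of spaces `Y_n ≺ X`. Gluing a `1`-Lipschitz map `X → Y_n` to the
coupling of `Y_n` and `Z` given by nearly optimal parameters yields couplings of `μ_X` and `μ_Z`
that barely expand distances on sets of nearly full mass. These couplings are tight; the support of
a limit does not expand distances at all, and full support of `μ_X` makes it the graph of a
`1`-Lipschitz map (`LipschitzWith.exists_of_approx_couplings`).

For the Lipschitz bound, a member of `𝒫_X ∩ 𝒳(k, k)` is the law of `k` bounded `1`-Lipschitz
functions on `X`. If `d_conc(X, Y) < ε`, each is Ky Fan `ε`-close to a `1`-Lipschitz function from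
`Y`; truncated and bundled, these give a member of `𝒫_Y ∩ 𝒳(k, k)` at box distance at most `max (2ε)
(kε) ≤ 4kε` (`MMSpace.exists_box_le_of_lipOne`). The weights `1/4k` and `2^{-k}` then give a total
of at most `ε`. -/

open Filter Topology ProbabilityTheory

/-! ### Couplings and their limits -/

/-- Gluing of a map `f : α → β` transporting `μ` to the first marginal of `ρ` with the
coupling `ρ`. -/
theorem exists_measure_prod_glue {α β γ : Type*} [MeasurableSpace α] [MeasurableSpace β]
    [MeasurableSpace γ] [StandardBorelSpace γ] [Nonempty γ] {μ : Measure α}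
    [IsProbabilityMeasure μ] {ρ : Measure (β × γ)} [IsProbabilityMeasure ρ] {f : α → β}
    (hf : Measurable f) (h : μ.map f = ρ.fst) :
    ∃ π : Measure (α × γ), IsProbabilityMeasure π ∧ π.fst = μ ∧
      π.map (Prod.map f id) = ρ := by
  -- Disintegrate `ρ` over `β` and pull the conditional kernel back along `f`.
  refine ⟨μ ⊗ₘ (ρ.condKernel.comap f hf), inferInstance, Measure.fst_compProd _ _, ?_⟩
  have hfm : Measurable (Prod.map f (id : γ → γ)) := hf.prodMap measurable_id
  ext s hs
  rw [Measure.map_apply hfm hs, Measure.compProd_apply (hfm hs)]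
  conv_rhs => rw [← ρ.disintegrate ρ.condKernel, Measure.compProd_apply hs, ← h]
  rw [lintegral_map (Kernel.measurable_kernel_prodMk_left hs) hf]
  rfl

/-- Couplings with prescribed marginals form a relatively compact set, hence every sequence of
couplings has a limit along any ultrafilter. -/
theorem exists_tendsto_coupling {α β ι : Type*} [MetricSpace α] [CompleteSpace α]
    [SecondCountableTopology α] [MeasurableSpace α] [BorelSpace α] [MetricSpace β]
    [CompleteSpace β] [SecondCountableTopology β] [MeasurableSpace β] [BorelSpace β]
    {μ : ProbabilityMeasure α} {ν : ProbabilityMeasure β} (l : Ultrafilter ι)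
    (π : ι → ProbabilityMeasure (α × β))
    (hμ : ∀ i, (π i).map measurable_fst.aemeasurable = μ)
    (hν : ∀ i, (π i).map measurable_snd.aemeasurable = ν) :
    ∃ π' : ProbabilityMeasure (α × β), Tendsto π l (𝓝 π') ∧
      π'.map measurable_fst.aemeasurable = μ ∧ π'.map measurable_snd.aemeasurable = ν := by
  have htight : IsTightMeasureSet
      {((m : ProbabilityMeasure (α × β)) : Measure (α × β)) | m ∈ range π} := by
    rw [isTightMeasureSet_iff_exists_isCompact_measure_compl_le]
    intro ε hε
    obtain ⟨K, hK, hK'⟩ := isTightMeasureSet_iff_exists_isCompact_measure_compl_le.1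
      (isTightMeasureSet_singleton (μ := (μ : Measure α))) (ε / 2) (ENNReal.half_pos hε.ne')
    obtain ⟨K₂, hK₂, hK₂'⟩ := isTightMeasureSet_iff_exists_isCompact_measure_compl_le.1
      (isTightMeasureSet_singleton (μ := (ν : Measure β))) (ε / 2) (ENNReal.half_pos hε.ne')
    refine ⟨K ×ˢ K₂, hK.prod hK₂, ?_⟩
    rintro _ ⟨_, ⟨i, rfl⟩, rfl⟩
    have h1 : (π i : Measure (α × β)) (Prod.fst ⁻¹' Kᶜ) ≤ ε / 2 := by
      rw [← Measure.map_apply measurable_fst hK.measurableSet.compl]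
      have := congrArg (fun m : ProbabilityMeasure α => (m : Measure α) Kᶜ) (hμ i)
      exact this.le.trans (hK' _ rfl)
    have h2 : (π i : Measure (α × β)) (Prod.snd ⁻¹' K₂ᶜ) ≤ ε / 2 := by
      rw [← Measure.map_apply measurable_snd hK₂.measurableSet.compl]
      have := congrArg (fun m : ProbabilityMeasure β => (m : Measure β) K₂ᶜ) (hν i)
      exact this.le.trans (hK₂' _ rfl)
    calc (π i : Measure (α × β)) (K ×ˢ K₂)ᶜ
        ≤ (π i : Measure (α × β)) (Prod.fst ⁻¹' Kᶜ ∪ Prod.snd ⁻¹' K₂ᶜ) := by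
          refine measure_mono fun p hp => ?_
          by_contra hcon
          simp only [mem_union, mem_preimage, mem_compl_iff, not_or, not_not] at hcon
          exact hp hcon
      _ ≤ ε / 2 + ε / 2 := (measure_union_le _ _).trans (add_le_add h1 h2)
      _ = ε := ENNReal.add_halves ε
  obtain ⟨π', -, hπ'⟩ := (isCompact_closure_of_isTightMeasureSet htight).ultrafilter_le_nhds
    (l.map π) (by
      rw [le_principal_iff]
      exact mem_of_superset (mem_map.2 (univ_mem' fun i => mem_range_self i)) subset_closure)
  have hlim : Tendsto π l (𝓝 π') := hπ'
  refine ⟨π', hlim, ?_, ?_⟩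
  · refine tendsto_nhds_unique
      (ProbabilityMeasure.tendsto_map_of_tendsto_of_continuous π π' hlim continuous_fst) ?_
    simp only [hμ]
    exact tendsto_const_nhds
  · refine tendsto_nhds_unique
      (ProbabilityMeasure.tendsto_map_of_tendsto_of_continuous π π' hlim continuous_snd) ?_
    simp only [hν]
    exact tendsto_const_nhds

/-- If `μ` has full support and the support of a coupling of `μ` and `ν` does not expand distances,
then the coupling is carried by the graph of a `1`-Lipschitz map. -/
theorem exists_lipschitzWith_of_coupling {α β : Type*} [MetricSpace α]
    [SecondCountableTopology α] [MeasurableSpace α] [BorelSpace α] [MetricSpace β]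
    [CompleteSpace β] [SecondCountableTopology β] [MeasurableSpace β] [BorelSpace β]
    {π : Measure (α × β)} (hfull : π.fst.support = univ)
    (h : ∀ p ∈ π.support, ∀ q ∈ π.support, edist p.2 q.2 ≤ edist p.1 q.1) :
    ∃ f : α → β, LipschitzWith 1 f ∧ π.fst.map f = π.snd := by
  -- Full support puts first coordinates of support points arbitrarily near `x`. Non-expansion makes
  -- the second coordinates Cauchy, and closedness of the support keeps the limit.
  have hdense : ∀ x : α, ∃ z, (x, z) ∈ π.support := by
    intro x
    have hx : ∀ n : ℕ, ∃ p ∈ π.support, dist p.1 x < 1 / (n + 1 : ℝ) := by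
      intro n
      have hpos : 0 < π (Prod.fst ⁻¹' Metric.ball x (1 / (n + 1 : ℝ))) := by
        rw [← Measure.fst_apply Metric.isOpen_ball.measurableSet]
        have : x ∈ π.fst.support := hfull ▸ mem_univ x
        exact (Measure.mem_support_iff_forall x).1 this _
          (Metric.ball_mem_nhds x Nat.one_div_pos_of_nat)
      obtain ⟨p, hp, hp'⟩ := Measure.nonempty_inter_support_of_pos hpos
      exact ⟨p, hp', hp⟩
    choose p hp hpx using hx
    have hlim : Tendsto (fun n => (p n).1) atTop (𝓝 x) :=
      tendsto_iff_dist_tendsto_zero.2 (squeeze_zero (fun _ => dist_nonneg)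
        (fun n => (hpx n).le) tendsto_one_div_add_atTop_nhds_zero_nat)
    have hcauchy : CauchySeq fun n => (p n).2 := by
      have hc := hlim.cauchySeq
      rw [EMetric.cauchySeq_iff] at hc ⊢
      intro ε hε
      obtain ⟨N, hN⟩ := hc ε hε
      exact ⟨N, fun m hm n hn => (h _ (hp m) _ (hp n)).trans_lt (hN m hm n hn)⟩
    obtain ⟨z, hz⟩ := cauchySeq_tendsto_of_complete hcauchy
    exact ⟨z, Measure.isClosed_support.mem_of_tendsto (hlim.prodMk_nhds hz)
      (Eventually.of_forall hp)⟩
  choose f hf using hdense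
  have hlip : LipschitzWith 1 f := fun x y => by
    simpa using h _ (hf x) _ (hf y)
  refine ⟨f, hlip, ?_⟩
  rw [Measure.fst, Measure.map_map hlip.continuous.measurable measurable_fst, Measure.snd]
  refine Measure.map_congr ?_
  filter_upwards [Measure.support_mem_ae (μ := π)] with p hp
  -- Two support points with equal first coordinates coincide, so `p.2 = f p.1`.
  have := h (p.1, f p.1) (hf p.1) p hp
  simpa using this

/-- Along an ultrafilter the couplings converge weakly as `ε → 0`. Every support point of the limit
is approached by points of the good sets `T`, so the error in the distance estimate disappears on
the support. -/
theorem LipschitzWith.exists_of_approx_couplings {α β : Type*} [MetricSpace α] [CompleteSpace α]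
    [SecondCountableTopology α] [MeasurableSpace α] [BorelSpace α] [MetricSpace β]
    [CompleteSpace β] [SecondCountableTopology β] [MeasurableSpace β] [BorelSpace β]
    {μ : Measure α} [IsProbabilityMeasure μ] {ν : Measure β} [IsProbabilityMeasure ν]
    (hfull : μ.support = univ)
    (h : ∀ ε : ℝ≥0∞, 0 < ε → ∃ π : Measure (α × β), IsProbabilityMeasure π ∧ π.fst = μ ∧
      π.snd = ν ∧ ∃ T : Set (α × β), MeasurableSet T ∧ 1 ≤ π T + ε ∧
        ∀ p ∈ T, ∀ q ∈ T, edist p.2 q.2 ≤ edist p.1 q.1 + ε) :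
    ∃ f : α → β, LipschitzWith 1 f ∧ μ.map f = ν := by
  have hε : ∀ n : ℕ, 0 < ((n : ℝ≥0∞) + 1)⁻¹ := fun n => by simp
  choose π hπ hfst hsnd T hTm hT hdist using fun n : ℕ => h _ (hε n)
  have hε0 : Tendsto (fun n : ℕ => ((n : ℝ≥0∞) + 1)⁻¹) (hyperfilter ℕ) (𝓝 0) := by
    have := (tendsto_add_atTop_iff_nat 1).2 ENNReal.tendsto_inv_nat_nhds_zero
    refine Tendsto.mono_left ?_ Nat.hyperfilter_le_atTop
    simpa using this
  obtain ⟨π', hlim, h1, h2⟩ := exists_tendsto_coupling (μ := ⟨μ, inferInstance⟩)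
    (ν := ⟨ν, inferInstance⟩) (hyperfilter ℕ) (fun n => ⟨π n, hπ n⟩)
    (fun n => Subtype.ext (hfst n)) (fun n => Subtype.ext (hsnd n))
  have h1' : (π' : Measure (α × β)).fst = μ := congrArg Subtype.val h1
  have h2' : (π' : Measure (α × β)).snd = ν := congrArg Subtype.val h2
  -- By the portmanteau inequality `π n U` eventually exceeds a fixed `c > 0`, while `T n` misses
  -- less than `c` of the mass.
  have hmeet : ∀ U : Set (α × β), IsOpen U → 0 < (π' : Measure (α × β)) U →
      ∀ᶠ n in (hyperfilter ℕ : Filter ℕ), (T n ∩ U).Nonempty := by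
    intro U hU hpos
    obtain ⟨c, hc0, hc⟩ := exists_between hpos
    have hlow := hc.trans_le (ProbabilityMeasure.le_liminf_measure_open_of_tendsto hlim hU)
    filter_upwards [eventually_lt_of_lt_liminf hlow, hε0.eventually_lt_const hc0] with n hn hn'
    by_contra hcon
    rw [not_nonempty_iff_eq_empty, ← disjoint_iff_inter_eq_empty] at hcon
    have : π n (T n) + π n U ≤ 1 := by
      rw [← measure_union hcon hU.measurableSet]
      exact prob_le_one
    have hlt : π n (T n) + ((n : ℝ≥0∞) + 1)⁻¹ < π n (T n) + π n U :=
      ENNReal.add_lt_add_left (measure_ne_top _ _) (hn'.trans hn)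
    exact absurd ((hT n).trans_lt hlt) (not_lt.2 this)
  obtain ⟨f, hf, hf'⟩ := exists_lipschitzWith_of_coupling (π := (π' : Measure (α × β)))
    (by rw [h1', hfull]) (by
      intro p hp q hq
      refine ENNReal.le_of_forall_pos_le_add fun δ hδ _ => ?_
      -- Five errors: two for moving each of `p` and `q`, one per coordinate, and one from the
      -- estimate on `T n`.
      set r : ℝ≥0∞ := (δ : ℝ≥0∞) / 5 with hr
      have hr0 : 0 < r := ENNReal.div_pos (by exact_mod_cast hδ.ne') (by simp)
      have hball : ∀ p ∈ (π' : Measure (α × β)).support,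
          0 < (π' : Measure (α × β)) (Metric.eball p r) := fun p hp =>
        (Measure.mem_support_iff_forall p).1 hp _ (Metric.eball_mem_nhds p hr0)
      obtain ⟨n, ⟨⟨p', hp'T, hp'⟩, ⟨q', hq'T, hq'⟩⟩, hn⟩ :=
        (((hmeet _ Metric.isOpen_eball (hball p hp)).and
          (hmeet _ Metric.isOpen_eball (hball q hq))).and
          (hε0.eventually_lt_const hr0)).exists
      have hp1 : edist p'.1 p.1 ≤ r := (le_max_left _ _).trans (le_of_lt hp')
      have hp2 : edist p'.2 p.2 ≤ r := (le_max_right _ _).trans (le_of_lt hp')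
      have hq1 : edist q'.1 q.1 ≤ r := (le_max_left _ _).trans (le_of_lt hq')
      have hq2 : edist q'.2 q.2 ≤ r := (le_max_right _ _).trans (le_of_lt hq')
      calc edist p.2 q.2 ≤ edist p.2 p'.2 + edist p'.2 q'.2 + edist q'.2 q.2 :=
            edist_triangle4 _ _ _ _
        _ ≤ r + (edist p'.1 q'.1 + r) + r := by
            rw [edist_comm p.2]
            gcongr
            exact (hdist n _ hp'T _ hq'T).trans (by gcongr)
        _ ≤ r + ((r + edist p.1 q.1 + r) + r) + r := by
            gcongr
            refine (edist_triangle4 p'.1 p.1 q.1 q'.1).trans ?_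
            rw [edist_comm q.1]
            gcongr
        _ = edist p.1 q.1 + 5 * r := by ring
        _ = edist p.1 q.1 + δ := by
            rw [hr, ENNReal.mul_div_cancel (by simp) (by simp)])
  exact ⟨f, hf, by rw [← h1', hf', h2']⟩

/-! ### `𝒫_X` is a pyramid -/

theorem MMSpace.exists_approx_coupling {X Y : MMSpace.{u}} {Z : MMSpace.{v}} (hYX : Y.Dom X)
    {ε : ℝ≥0∞} (hbox : Y.box Z < ε) :
    ∃ π : Measure (X × Z), IsProbabilityMeasure π ∧ π.fst = X.μ ∧
      π.snd = Z.μ ∧ ∃ T : Set (X × Z), MeasurableSet T ∧ 1 ≤ π T + ε ∧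
        ∀ p ∈ T, ∀ q ∈ T, edist p.2 q.2 ≤ edist p.1 q.1 + ε := by
  obtain ⟨f, hf, hfμ⟩ := hYX
  rw [MMSpace.box, MMSpace.paramInf, iInf_lt_iff] at hbox
  obtain ⟨φ, hbox⟩ := hbox
  rw [iInf_lt_iff] at hbox
  obtain ⟨ψ, hbox⟩ := hbox
  rw [boxPseudo, sInf_lt_iff] at hbox
  obtain ⟨δ, ⟨I₀, hI₀, hd, hI₀'⟩, hδ⟩ := hbox
  have : SecondCountableTopology X := UniformSpace.secondCountable_of_separable X
  have : SecondCountableTopology Y := UniformSpace.secondCountable_of_separable Y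
  have : SecondCountableTopology Z := UniformSpace.secondCountable_of_separable Z
  have : Nonempty Z := nonempty_of_isProbabilityMeasure Z.μ
  have hpair : Measurable fun s => (φ.1 s, ψ.1 s) := φ.2.1.prodMk ψ.2.1
  set ρ : Measure (Y × Z) := lebI.map fun s => (φ.1 s, ψ.1 s) with hρ
  have hρ1 : ρ.fst = Y.μ := by
    rw [hρ, Measure.fst_map_prodMk ψ.2.1, φ.2.2]
  have hρ2 : ρ.snd = Z.μ := by
    rw [hρ, Measure.snd_map_prodMk φ.2.1, ψ.2.2]
  have : IsProbabilityMeasure ρ := ⟨by rw [← Measure.fst_univ, hρ1, measure_univ]⟩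
  obtain ⟨π, hπ, hπ1, hπ2⟩ := exists_measure_prod_glue (ρ := ρ) hf.continuous.measurable
    (hfμ.trans hρ1.symm)
  have hfm : Measurable (Prod.map f (id : Z → Z)) :=
    hf.continuous.measurable.prodMap measurable_id
  -- The image of a Borel set need not be Borel; its closure is, and it inherits the non-strict
  -- estimate.
  set C : Set (Y × Z) := closure ((fun s => (φ.1 s, ψ.1 s)) '' I₀) with hC
  have hCd : ∀ p ∈ C, ∀ q ∈ C, edist p.2 q.2 ≤ edist p.1 q.1 + δ := by
    intro p hp q hq
    have hcl : IsClosed {x : (Y × Z) × (Y × Z) |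
        edist x.1.2 x.2.2 ≤ edist x.1.1 x.2.1 + δ} :=
      isClosed_le (by fun_prop) (by fun_prop)
    have hmem : (p, q) ∈ closure (((fun s => (φ.1 s, ψ.1 s)) '' I₀) ×ˢ
        ((fun s => (φ.1 s, ψ.1 s)) '' I₀)) := by
      rw [closure_prod_eq]
      exact ⟨hp, hq⟩
    refine closure_minimal ?_ hcl hmem
    rintro ⟨_, _⟩ ⟨⟨s, hs, rfl⟩, ⟨t, ht, rfl⟩⟩
    change edist (ψ.1 s) (ψ.1 t) ≤ edist (φ.1 s) (φ.1 t) + δ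
    rw [edist_dist, edist_dist]
    refine le_trans ?_ (add_le_add le_rfl (hd s hs t ht))
    rw [← ENNReal.ofReal_add dist_nonneg (abs_nonneg _)]
    refine ENNReal.ofReal_le_ofReal ?_
    have := neg_abs_le (φ.pull s t - ψ.pull s t)
    simp only [MMSpace.Param.pull] at this ⊢
    linarith
  refine ⟨π, hπ, hπ1, ?_, Prod.map f id ⁻¹' C, hfm isClosed_closure.measurableSet, ?_, ?_⟩
  · rw [← hρ2, ← hπ2, Measure.snd, Measure.snd, Measure.map_map measurable_snd hfm]
    rfl
  · rw [← Measure.map_apply hfm isClosed_closure.measurableSet, hπ2, hρ,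
      Measure.map_apply hpair isClosed_closure.measurableSet]
    refine hI₀'.trans (add_le_add (measure_mono fun s hs => ?_) hδ.le)
    exact subset_closure ⟨s, hs, rfl⟩
  · intro p hp q hq
    refine (hCd _ hp _ hq).trans (add_le_add ?_ hδ.le)
    simpa using hf p.1 q.1

/-- A box limit of mm-spaces dominated by `X` is dominated by `X`. -/
theorem MMSpace.dom_of_forall_box_lt {X : MMSpace.{u}} {Z : MMSpace.{v}}
    (h : ∀ ε : ℝ≥0∞, 0 < ε → ∃ Y : MMSpace.{u}, Y.Dom X ∧ Y.box Z < ε) : Z.Dom X := by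
  have : SecondCountableTopology X := UniformSpace.secondCountable_of_separable X
  have : SecondCountableTopology Z := UniformSpace.secondCountable_of_separable Z
  refine LipschitzWith.exists_of_approx_couplings X.supp_eq fun ε hε => ?_
  obtain ⟨Y, hY, hbox⟩ := h ε hε
  exact MMSpace.exists_approx_coupling hY hbox

theorem MMSpace.isPyramid_dominated (X : MMSpace.{u}) : IsPyramid X.dominated where
  lower x hx y hy := by
    induction x using Quotient.inductionOn with | _ A => ?_
    induction y using Quotient.inductionOn with | _ B => ?_
    exact MMSpace.Dom.trans hy hx
  directed x hx x' hx' := ⟨X.cls, (MMSpace.Iso.refl X).dom, hx, hx'⟩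
  nonempty := ⟨X.cls, (MMSpace.Iso.refl X).dom⟩
  closed x h := by
    induction x using Quotient.inductionOn with | _ Z => ?_
    refine MMSpace.dom_of_forall_box_lt (X := X) (Z := Z) fun ε hε => ?_
    obtain ⟨y, hy, hbox⟩ := h ε hε
    induction y using Quotient.inductionOn with | _ Y => ?_
    exact ⟨Y, hy, hbox⟩

/-! ### Images of mm-spaces under Lipschitz maps -/

theorem MMSpace.apply_mem_support_map (X : MMSpace.{u}) {α : Type*} [TopologicalSpace α]
    [MeasurableSpace α] [BorelSpace α] {f : X → α} (hf : Continuous f) (x : X) :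
    f x ∈ (X.μ.map f).support := by
  rw [Measure.mem_support_iff_forall]
  intro U hU
  have hx : x ∈ X.μ.support := X.supp_eq ▸ mem_univ x
  exact ((Measure.mem_support_iff_forall x).1 hx _ (hf.continuousAt hU)).trans_le
    (Measure.le_map_apply hf.measurable.aemeasurable U)

/-- Every mm-space has an isomorphic copy in a larger universe. -/
theorem MMSpace.exists_iso_ulift (X : MMSpace.{u}) : ∃ X' : MMSpace.{max u v}, X.Iso X' := by
  let : MeasurableSpace (ULift.{v} X) := _root_.borel _
  have : BorelSpace (ULift.{v} X) := ⟨rfl⟩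
  let e : X ≃ᵢ ULift.{v} X := ⟨Equiv.ulift.symm, fun _ _ => rfl⟩
  have : IsProbabilityMeasure (X.μ.map e) :=
    Measure.isProbabilityMeasure_map e.continuous.measurable.aemeasurable
  refine ⟨{ carrier := ULift.{v} X
            complete := e.symm.completeSpace
            separable := e.surjective.denseRange.separableSpace e.continuous
            μ := X.μ.map e
            supp_eq := eq_univ_of_forall fun y => ?_ }, e, rfl⟩
  obtain ⟨x, rfl⟩ := e.surjective y
  exact X.apply_mem_support_map e.continuous x

/-- The image of an mm-space under a `1`-Lipschitz map, represented in its own universe. -/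
theorem MMSpace.exists_map (Y : MMSpace.{u}) {α : Type} [MetricSpace α] [CompleteSpace α]
    [TopologicalSpace.SeparableSpace α] [MeasurableSpace α] [BorelSpace α] {H : Y → α}
    (hH : LipschitzWith 1 H) [IsProbabilityMeasure (Y.μ.map H)] :
    ∃ (Y' : MMSpace.{u}) (h : Y → Y'), LipschitzWith 1 h ∧ Y.μ.map h = Y'.μ ∧
      (∀ a b, dist (h a) (h b) = dist (H a) (H b)) ∧
      Y'.Iso (MMSpace.ofMeasure (Y.μ.map H)) := by
  -- The image measure lives on `α : Type`, so its mm-space is lifted to the universe of `Y`.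
  obtain ⟨Y', hY'⟩ := MMSpace.exists_iso_ulift.{0, u} (MMSpace.ofMeasure (Y.μ.map H))
  obtain ⟨e, he⟩ := id hY'
  let H' : Y → MMSpace.ofMeasure (Y.μ.map H) := fun y =>
    ⟨H y, Y.apply_mem_support_map hH.continuous y⟩
  have hH' : LipschitzWith 1 H' := hH
  have hmap : Y.μ.map H' = (MMSpace.ofMeasure (Y.μ.map H)).μ := by
    have hemb : MeasurableEmbedding (Subtype.val : (Y.μ.map H).support → α) :=
      .subtype_coe Measure.isClosed_support.measurableSet
    have : (Y.μ.map H').map Subtype.val = Y.μ.map H :=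
      Measure.map_map measurable_subtype_coe hH'.continuous.measurable
    refine (hemb.comap_map _).symm.trans ?_
    exact congrArg (Measure.comap Subtype.val) this
  refine ⟨Y', e ∘ H', ?_, ?_, fun a b => ?_, hY'.symm⟩
  · simpa using e.isometry.lipschitz.comp hH'
  · rw [← Measure.map_map e.continuous.measurable hH'.continuous.measurable, hmap, he]
  · exact e.isometry.dist_eq _ _

/-! ### From Ky Fan closeness to box closeness -/

theorem measure_lt_ofReal_le_of_kyFan_lt {f g : UInt01 → ℝ} {ε : ℝ≥0∞} (h : kyFan f g < ε) :
    lebI {s | ε < ENNReal.ofReal |f s - g s|} ≤ ε := by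
  rw [kyFan, sInf_lt_iff] at h
  obtain ⟨δ, hδ, hδε⟩ := h
  exact (measure_mono fun s hs => hδε.trans hs).trans (le_trans hδ hδε.le)

/-- A function on `I` that is `1`-Lipschitz for `ψ^* d_Y` factors through a `1`-Lipschitz
function on `Y`. -/
theorem MMSpace.Param.exists_lipschitzWith_comp_eq {Y : MMSpace.{u}} (ψ : Y.Param)
    {ι : Type*} [Fintype ι] (g : UInt01 → ι → ℝ) (hg : ∀ s t, dist (g s) (g t) ≤ ψ.pull s t) :
    ∃ H : Y → ι → ℝ, LipschitzWith 1 H ∧ ∀ s, H (ψ.1 s) = g s := by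
  -- The Lipschitz bound makes `g` constant on the fibres of `ψ`. The range of `ψ` may miss points
  -- of `Y`, hence the extension below.
  have hfactor : ∀ s, g (Function.invFun ψ.1 (ψ.1 s)) = g s := fun s => by
    have hs : ψ.1 (Function.invFun ψ.1 (ψ.1 s)) = ψ.1 s := Function.invFun_eq ⟨s, rfl⟩
    exact dist_le_zero.1 ((hg _ s).trans (dist_eq_zero.2 hs).le)
  have hlip : LipschitzOnWith 1 (fun y => g (Function.invFun ψ.1 y)) (range ψ.1) := by
    refine LipschitzOnWith.of_dist_le_mul ?_
    rintro _ ⟨s, rfl⟩ _ ⟨t, rfl⟩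
    simpa [hfactor, MMSpace.Param.pull] using hg s t
  obtain ⟨H, hH, hH'⟩ := hlip.extend_pi
  exact ⟨H, hH, fun s => (hH' ⟨s, rfl⟩).symm.trans (hfactor s)⟩

theorem MMSpace.Param.isProbabilityMeasure_lebI {X : MMSpace.{u}} (φ : X.Param) :
    IsProbabilityMeasure lebI :=
  ⟨by rw [← preimage_univ (f := φ.1), ← Measure.map_apply φ.2.1 .univ, φ.2.2, measure_univ]⟩

/-- The composition of a parameter with a measure preserving map. -/
def MMSpace.Param.comp {X : MMSpace.{u}} {X' : MMSpace.{v}} (φ : X.Param) {f : X → X'}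
    (hf : Measurable f) (hfμ : X.μ.map f = X'.μ) : X'.Param :=
  ⟨f ∘ φ.1, hf.comp φ.2.1, by rw [← Measure.map_map hf φ.2.1, φ.2.2, hfμ]⟩

theorem MMSpace.box_le_of_map {X X' : MMSpace.{u}} {Y Y' : MMSpace.{v}} (φ : X.Param) (ψ : Y.Param)
    {f : X → X'} {h : Y → Y'} (hf : Measurable f) (hfμ : X.μ.map f = X'.μ) (hh : Measurable h)
    (hhμ : Y.μ.map h = Y'.μ) {δ : ℝ≥0∞} {I₀ : Set UInt01} (hI₀ : MeasurableSet I₀)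
    (hd : ∀ s ∈ I₀, ∀ t ∈ I₀, ENNReal.ofReal
      |dist (f (φ.1 s)) (f (φ.1 t)) - dist (h (ψ.1 s)) (h (ψ.1 t))| ≤ δ)
    (hI₀' : 1 ≤ lebI I₀ + δ) : X'.box Y' ≤ δ := by
  have hbox : boxPseudo (φ.comp hf hfμ).pull (ψ.comp hh hhμ).pull ≤ δ :=
    sInf_le ⟨I₀, hI₀, hd, hI₀'⟩
  rw [MMSpace.box, MMSpace.paramInf]
  exact iInf_le_of_le (φ.comp hf hfμ) (iInf_le_of_le (ψ.comp hh hhμ) hbox)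

/-- If two maps `F, G : I → ℝ^N` have coordinates that are `ε`-close in the Ky Fan metric, then
they are uniformly `ε`-close outside a set of measure at most `N ε`. -/
theorem one_le_lebI_edist_le_add [IsProbabilityMeasure lebI] {N : ℕ} {F G : UInt01 → Fin N → ℝ}
    {ε : ℝ≥0∞} (h : ∀ i, kyFan (fun s => F s i) (fun s => G s i) < ε) :
    1 ≤ lebI {s | edist (F s) (G s) ≤ ε} + N * ε := by
  have hcompl : lebI {s | edist (F s) (G s) ≤ ε}ᶜ ≤ N * ε := by
    calc lebI {s | edist (F s) (G s) ≤ ε}ᶜ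
        ≤ lebI (⋃ i, {s | ε < ENNReal.ofReal |F s i - G s i|}) := by
          refine measure_mono fun s hs => ?_
          obtain ⟨i, hi⟩ := not_forall.1 (mt edist_pi_le_iff.2 hs)
          rw [not_le, edist_dist, Real.dist_eq] at hi
          exact mem_iUnion.2 ⟨i, hi⟩
      _ ≤ ∑ i, lebI {s | ε < ENNReal.ofReal |F s i - G s i|} := measure_iUnion_fintype_le _ _
      _ ≤ ∑ _i : Fin N, ε := Finset.sum_le_sum fun i _ => measure_lt_ofReal_le_of_kyFan_lt (h i)
      _ = N * ε := by simp
  calc (1 : ℝ≥0∞) = lebI univ := measure_univ.symm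
    _ ≤ lebI {s | edist (F s) (G s) ≤ ε} + lebI {s | edist (F s) (G s) ≤ ε}ᶜ := by
      rw [← union_compl_self {s | edist (F s) (G s) ≤ ε}]
      exact measure_union_le _ _
    _ ≤ _ := add_le_add le_rfl hcompl

/-- One half of the Hausdorff estimate; exchanging `φ` and `ψ` gives the other. Distances change by
at most `2 * ε` on a set whose complement has measure at most `N * ε`, which explains the two
conditions on `δ`. -/
theorem MMSpace.exists_box_le_of_lipOne {X Y : MMSpace.{u}} (φ : X.Param) (ψ : Y.Param)
    {ε δ : ℝ≥0∞} (h : ∀ a ∈ lipOne φ.pull, (⨅ b ∈ lipOne ψ.pull, kyFan a b) < ε) {N : ℕ} {R : ℝ}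
    (hR : 0 ≤ R) (hδ : 2 * ε ≤ δ) (hδ' : N * ε ≤ δ) {x : MMClass.{u}}
    (hx : x ∈ X.dominated ∩ XNR N R) :
    ∃ y ∈ Y.dominated ∩ XNR N R, x.box y ≤ δ := by
  obtain ⟨hxd, X', m, hm, rfl, hsupp, e, he⟩ := hx
  obtain ⟨f, hf, hfμ⟩ : X'.Dom X := hxd
  have := φ.isProbabilityMeasure_lebI
  have hval : Isometry (fun x' => (e x').1) := isometry_subtype_coe.comp e.isometry
  set F : UInt01 → Fin N → ℝ := fun s => (e (f (φ.1 s))).1 with hF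
  have hFm : Measurable F := hval.continuous.measurable.comp
    (hf.continuous.measurable.comp φ.2.1)
  have hFball : ∀ s i, |F s i| ≤ R := fun s i => by
    have := mem_closedBall_zero_iff.1 (hsupp (e (f (φ.1 s))).2)
    exact (norm_le_pi_norm (F s) i).trans this
  have hFlip : ∀ i, (fun s => F s i) ∈ lipOne φ.pull := fun i s t => by
    rw [← Real.dist_eq]
    refine (dist_le_pi_dist _ _ i).trans ((hval.dist_eq _ _).le.trans ?_)
    simpa [MMSpace.Param.pull] using hf.dist_le_mul (φ.1 s) (φ.1 t)
  have hclose : ∀ i, ∃ b ∈ lipOne ψ.pull, kyFan (fun s => F s i) b < ε := fun i => by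
    simpa [iInf_lt_iff] using h _ (hFlip i)
  choose b hb hbε using hclose
  -- Truncation puts the approximants in the ball. Being `1`-Lipschitz and fixing the values of `F`,
  -- it spoils neither the Lipschitz bound nor the Ky Fan bound.
  let c : ℝ → ℝ := fun r => max (-R) (min R r)
  have hc : LipschitzWith 1 c := (LipschitzWith.id.const_min R).const_max (-R)
  have hcd : ∀ p q, |c p - c q| ≤ |p - q| := fun p q => by
    simpa [Real.dist_eq] using hc.dist_le_mul p q
  have hcR : ∀ r, |c r| ≤ R := fun r =>
    abs_le.2 ⟨le_max_left _ _, max_le (by linarith) (min_le_left _ _)⟩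
  have hcF : ∀ s i, c (F s i) = F s i := fun s i => by
    obtain ⟨h1, h2⟩ := abs_le.1 (hFball s i)
    simp only [c]
    rw [min_eq_right h2, max_eq_right h1]
  obtain ⟨H, hH, hHψ⟩ := ψ.exists_lipschitzWith_comp_eq (fun s i => c (b i s)) fun s t =>
    (dist_pi_le_iff dist_nonneg).2 fun i => (hcd _ _).trans (hb i s t)
  have hHm := hH.continuous.measurable
  have : IsProbabilityMeasure (Y.μ.map H) := Measure.isProbabilityMeasure_map hHm.aemeasurable
  obtain ⟨Y', g, hg, hgμ, hgd, hgiso⟩ := Y.exists_map hH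
  refine ⟨Y'.cls, ⟨⟨g, hg, hgμ⟩, Y', Y.μ.map H, ‹_›, rfl, ?_, hgiso⟩, ?_⟩
  -- The extension `H` may leave the ball away from the range of `ψ`; only almost every value
  -- matters.
  · refine Measure.support_subset_of_isClosed Metric.isClosed_closedBall ?_
    rw [← ψ.2.2, Measure.map_map hHm ψ.2.1]
    refine (ae_map_iff (hHm.comp ψ.2.1).aemeasurable Metric.isClosed_closedBall.measurableSet).2
      (Eventually.of_forall fun s => ?_)
    refine mem_closedBall_zero_iff.2 ((pi_norm_le_iff_of_nonneg hR).2 fun i => ?_)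
    exact (congrArg abs (congrFun (hHψ s) i)).trans_le (hcR _)
  · have hI : 1 ≤ lebI {s | edist (F s) (H (ψ.1 s)) ≤ ε} + N * ε := by
      refine one_le_lebI_edist_le_add fun i => lt_of_le_of_lt ?_ (hbε i)
      refine sInf_le_sInf fun η hη => (measure_mono fun s hs => ?_).trans hη
      refine lt_of_lt_of_le hs (ENNReal.ofReal_le_ofReal ?_)
      calc |F s i - H (ψ.1 s) i| = |c (F s i) - c (b i s)| := by
            rw [hcF, congrFun (hHψ s) i]
        _ ≤ |F s i - b i s| := hcd _ _
    refine MMSpace.box_le_of_map φ ψ hf.continuous.measurable hfμ hg.continuous.measurable hgμ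
      (I₀ := {s | edist (F s) (H (ψ.1 s)) ≤ ε})
      (measurableSet_le (hFm.edist (hHm.comp ψ.2.1)) measurable_const) ?_
      (hI.trans (add_le_add le_rfl hδ'))
    intro s hs t ht
    refine le_trans ?_ hδ
    rw [hgd, ← hval.dist_eq, two_mul]
    refine le_trans ?_ (add_le_add (show edist (F s) (H (ψ.1 s)) ≤ ε from hs)
      (show edist (F t) (H (ψ.1 t)) ≤ ε from ht))
    rw [edist_dist, edist_dist, ← ENNReal.ofReal_add dist_nonneg dist_nonneg, ← Real.dist_eq]
    exact ENNReal.ofReal_le_ofReal (dist_dist_dist_le _ _ _ _)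

/-! ### The estimate for `ρ` -/

theorem MMSpace.hausdorffOf_box_le {X Y : MMSpace.{u}} {ε : ℝ≥0∞} (h : X.dconc Y < ε) (k : ℕ)
    (hk : 1 ≤ k) :
    hausdorffOf MMClass.box (X.dominated ∩ XNR k k) (Y.dominated ∩ XNR k k) ≤ 4 * k * ε := by
  rw [MMSpace.dconc, MMSpace.paramInf, iInf_lt_iff] at h
  obtain ⟨φ, h⟩ := h
  rw [iInf_lt_iff] at h
  obtain ⟨ψ, h⟩ := h
  rw [dconcPseudo, hausdorffOf, sInf_lt_iff] at h
  obtain ⟨η, ⟨h1, h2⟩, hη⟩ := h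
  have hk' : (1 : ℝ≥0∞) ≤ k := by exact_mod_cast hk
  -- The normalising factor `4 * k` absorbs both `2` and `k`; the former uses `1 ≤ k`.
  have hδ : 2 * ε ≤ 4 * k * ε := by
    gcongr
    calc (2 : ℝ≥0∞) ≤ 4 * 1 := by norm_num
      _ ≤ 4 * k := by gcongr
  have hδ' : (k : ℝ≥0∞) * ε ≤ 4 * k * ε := by
    gcongr
    exact le_mul_of_one_le_left zero_le (by norm_num)
  refine sInf_le ⟨fun x hx => ?_, fun y hy => ?_⟩
  · obtain ⟨y, hy, hxy⟩ := MMSpace.exists_box_le_of_lipOne φ ψ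
      (fun a ha => (h1 a ha).trans_lt hη) k.cast_nonneg hδ hδ' hx
    exact (iInf₂_le y hy).trans hxy
  · obtain ⟨x, hx, hxy⟩ := MMSpace.exists_box_le_of_lipOne ψ φ
      (fun a ha => (h2 a ha).trans_lt hη) k.cast_nonneg hδ hδ' hy
    exact (iInf₂_le x hx).trans hxy

/-- The pyramid `𝒫_X`. -/
def MMSpace.pyramid (X : MMSpace.{u}) : Pyramid.{u} := ⟨X.dominated, X.isPyramid_dominated⟩

theorem MMSpace.rho_pyramid_le (X Y : MMSpace.{u}) :
    Pyramid.rho X.pyramid Y.pyramid ≤ X.dconc Y := by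
  -- The infima in `dconc` need not be attained, so the bound is proved for every larger `ε`.
  refine le_of_forall_gt_imp_ge_of_dense fun ε hε => ?_
  have hk : ∀ k : ℕ, Pyramid.rhoK (k + 1) X.pyramid Y.pyramid ≤ ε := fun k => by
    rw [Pyramid.rhoK, mul_comm, ← div_eq_mul_inv]
    refine ENNReal.div_le_of_le_mul ?_
    rw [mul_comm ε]
    exact MMSpace.hausdorffOf_box_le hε (k + 1) (Nat.le_add_left _ _)
  calc Pyramid.rho X.pyramid Y.pyramid ≤ ∑' k : ℕ, (2⁻¹ : ℝ≥0∞) ^ (k + 1) * ε :=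
        ENNReal.tsum_le_tsum fun k => by gcongr; exact hk k
    _ = ε := by
      rw [ENNReal.tsum_mul_right, ENNReal.tsum_geometric_add_one, ENNReal.one_sub_inv_two, inv_inv,
        ENNReal.inv_mul_cancel (by simp) (by simp), one_mul]

theorem MMSpace.dominated_congr {X Y : MMSpace.{u}} (h : X.Iso Y) : X.dominated = Y.dominated :=
  congrArg (fun y : MMClass.{u} => {x : MMClass.{u} | x.Dom y}) (Quotient.sound h)

theorem mainTheorem4 :
    ∃ ι : MMClass.{u} → Pyramid.{u},
      (∀ X : MMSpace.{u}, (ι X.cls).1 = X.dominated) ∧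
      (∀ X Y : MMSpace.{u}, Pyramid.rho (ι X.cls) (ι Y.cls) ≤ X.dconc Y) ∧
      (∀ x y : MMClass.{u}, Pyramid.rho (ι x) (ι y) ≤ MMClass.dconc x y) := by
  refine ⟨Quotient.lift MMSpace.pyramid fun X Y h => Subtype.ext (MMSpace.dominated_congr h),
    fun X => rfl, MMSpace.rho_pyramid_le, fun x y => ?_⟩
  induction x using Quotient.inductionOn with | _ X => ?_
  induction y using Quotient.inductionOn with | _ Y => ?_
  exact MMSpace.rho_pyramid_le X Y
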